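/- Let $G$ be a finite connected simple bipartite plane graph (an outer face $F_{\rm out}$ is fixed) with a fixed proper coloring of its vertices in black and white, and let $s_0\neq s_1$ be two vertices on the outer face. Let $B$ label the angles of $G$ by $0$ and $1$. Consider the rules: (G0) every angle at $s_i$ has label $i$ ($i=0,1$). (G1) at every vertex $v\notin\{s_0,s_1\}$ the labels, in cyclic order, form a non-empty interval of $0$s and a non-empty interval of $1$s. (G2) for each edge, the two labels incident to it at one endpoint coincide, and the two labels incident to it at the other endpoint differ. (G2$^+$) for each edge, write $w_L,w_R$ (resp. $b_L,b_R$) for the labels incident to it at its white (resp. black) end, on the left and right when the edge is traversed from its white end to its black end; then for some $i\in\{0,1\}$, $(w_L,w_R,b_L,b_R)$ is $(1-i,i,i,i)$ (directed from white to black), $(i,i,1-i,i)$ (directed from black to white), or $(1-i,i,i,1-i)$ (bidirected). (G3$^+_Q$) the labels of each face (including the outer one) are cyclically $0011$, and the labels of the outer face, read in clockwise order starting at $s_0$, are $0011$. (G3$^+$) each face (including the outer one) has exactly one pair of adjacent $0$-labels and exactly one pair of adjacent $1$-labels; moreover the edge of the outer face which contains $s_0$ and has $F_{\rm out}$ on its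 right when traversed from its white end to its black end has two adjacent labels $0$ in $F_{\rm out}$. If $G$ is a quadrangulation (all faces, including the outer one, have degree four) and $s_0,s_1$ are its two black vertices on the outer face, $B$ is a *strong labeling* if it satisfies (G0), (G1), (G2), (G3$^+_Q$). For arbitrary $G$ as above (with $s_0,s_1$ of any color), $B$ is a *generalized strong labeling* if it satisfies (G0), (G1), (G2$^+$), (G3$^+$). An edge with coinciding labels at exactly one endpoint is directed towards that endpoint and gets the coinciding label as its color. A bidirected edge gets both directions, the direction leaving its white end having color $w_R$ and the direction leaving its black end having color $b_R$. Let $T_i$ be the set of directed edges of color $i$, and $T_i^{-1}$ the set of their reversals. 1. For a strong labeling of a quadrangulation, each $T_i$, $i\in\{0,1\}$, is a directed tree with sink $s_i$ (all edges directed towards $s_i$) that spans all vertices except $s_{1-i}$. 2. For a generalized strong labeling, $T_0\cup T_1^{-1}$ and $T_1\cup T_0^{-1}$ contain no directed cycle, and each $T_i$, $i\in\{0,1\}$, is a directed tree with sink $s_i$ that spans all vertices except $s_{1-i}$. -/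

import Mathlib

/-!
Finite connected plane graphs are given by their combinatorial embedding: a simple graph `G`, for
each vertex the counterclockwise cyclic order of the darts (oriented edges) leaving it, Euler's
formula (the embedding is on the sphere), and a distinguished outer face.
-/

/-- A finite connected plane graph with underlying graph `G`, without its outer face.
`rot d` is the dart that follows `d` in counterclockwise order around the tail `d.fst` of `d`. -/
structure SphericalEmbedding {V : Type*} (G : SimpleGraph V) where
  rot : Equiv.Perm G.Dart
  rot_sameCycle_iff : ∀ d e : G.Dart, rot.SameCycle d e ↔ d.fst = e.fst
  connected : G.Connected
  /-- Euler's formula; the faces are the cycles of `d ↦ rot d.symm`. -/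
  euler : Nat.card V +
      Nat.card (Quotient (Equiv.Perm.SameCycle.setoid
        ((Function.Involutive.toPerm SimpleGraph.Dart.symm
          SimpleGraph.Dart.symm_involutive).trans rot))) =
    Nat.card G.edgeSet + 2

namespace SphericalEmbedding

variable {V : Type*} {G : SimpleGraph V} (M : SphericalEmbedding G)

/-- The dart after `d` on the boundary of the face lying to the right of `d`, when this boundary
is walked with the face on the right (i.e. clockwise for a bounded face). -/
def next : Equiv.Perm G.Dart :=
  (Function.Involutive.toPerm SimpleGraph.Dart.symm SimpleGraph.Dart.symm_involutive).trans M.rot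

theorem next_apply (d : G.Dart) : M.next d = M.rot d.symm := rfl

/-- The faces. -/
def Face : Type _ := Quotient (Equiv.Perm.SameCycle.setoid M.next)

/-- The face to the right of the dart `d`. -/
def faceRight (d : G.Dart) : M.Face := Quotient.mk (Equiv.Perm.SameCycle.setoid M.next) d

end SphericalEmbedding

/-- A finite connected plane graph: a spherical embedding with a chosen outer face. -/
structure PlaneGraph {V : Type*} (G : SimpleGraph V) extends SphericalEmbedding G where
  outer : toSphericalEmbedding.Face

/-- A labeling of the angles by `0` and `1`. An angle is represented by the dart `d` with the
angle on its right: `B d` is the label of the angle at `d.fst` between `d` and its clockwise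
neighbour. This angle lies in the face `faceRight d`. -/
abbrev AngleLabeling {V : Type*} (G : SimpleGraph V) := G.Dart → Fin 2

/-- The label at the tail of `d`, right of `d`. -/
def AngleLabeling.tailRight {V : Type*} {G : SimpleGraph V} (B : AngleLabeling G)
    (_M : SphericalEmbedding G) (d : G.Dart) : Fin 2 := B d

/-- The label at the tail of `d`, left of `d`. -/
def AngleLabeling.tailLeft {V : Type*} {G : SimpleGraph V} (B : AngleLabeling G)
    (M : SphericalEmbedding G) (d : G.Dart) : Fin 2 := B (M.rot d)

/-- The label at the head of `d`, right of `d`. -/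
def AngleLabeling.headRight {V : Type*} {G : SimpleGraph V} (B : AngleLabeling G)
    (M : SphericalEmbedding G) (d : G.Dart) : Fin 2 := B (M.rot d.symm)

/-- The label at the head of `d`, left of `d`. -/
def AngleLabeling.headLeft {V : Type*} {G : SimpleGraph V} (B : AngleLabeling G)
    (_M : SphericalEmbedding G) (d : G.Dart) : Fin 2 := B d.symm

namespace PlaneGraph

variable {V : Type*} {G : SimpleGraph V} (P : PlaneGraph G)

/-- The vertex `v` lies on the outer face. -/
def OnOuterFace (v : V) : Prop := ∃ d : G.Dart, d.fst = v ∧ P.faceRight d = P.outer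

/-- (G0): `s 0` and `s 1` are two vertices on the outer face, and all angles at `s i` are
labeled `i`. -/
def SpecialVertices (s : Fin 2 → V) (B : AngleLabeling G) : Prop :=
  s 0 ≠ s 1 ∧ ∀ i, P.OnOuterFace (s i) ∧ ∀ d : G.Dart, d.fst = s i → B d = i

/-- (G1): at each non-special vertex the labels, in cyclic order, form a non-empty interval of 0s
and a non-empty interval of 1s, i.e. there is exactly one place where a 0 is followed by a 1. -/
def VertexRule (s : Fin 2 → V) (B : AngleLabeling G) : Prop :=
  ∀ v, v ≠ s 0 → v ≠ s 1 → ∃! d : G.Dart, d.fst = v ∧ B d = 0 ∧ B (P.rot d) = 1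

/-- (G2): for each edge the incident labels coincide at one endpoint and differ at the other. -/
def EdgeRule (B : AngleLabeling G) : Prop :=
  ∀ d : G.Dart, Xor (B.tailLeft P.toSphericalEmbedding d = B.tailRight P.toSphericalEmbedding d)
    (B.headLeft P.toSphericalEmbedding d = B.headRight P.toSphericalEmbedding d)

/-- All faces, including the outer one, have degree four. -/
def IsQuadrangulation : Prop :=
  ∀ F : P.Face, Nat.card {d : G.Dart // P.faceRight d = F} = 4

/-- Strong face rule for quadrangulations: the labels of each face are cyclically 0011, and the
labels of the outer face are 0011 when read in clockwise order starting at `s 0`. (Walking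
clockwise around the graph has the outer face on the left, hence goes along the inverse of
`next`.) -/
def QuadFaceRule (s : Fin 2 → V) (B : AngleLabeling G) : Prop :=
  (∀ F : P.Face, ∃ d : G.Dart, P.faceRight d = F ∧
    B d = 0 ∧ B (P.next d) = 0 ∧
    B (P.next (P.next d)) = 1 ∧ B (P.next (P.next (P.next d))) = 1) ∧
  ∃ d : G.Dart, P.faceRight d = P.outer ∧ d.fst = s 0 ∧
    B d = 0 ∧ B (P.next.symm d) = 0 ∧
    B (P.next.symm (P.next.symm d)) = 1 ∧
    B (P.next.symm (P.next.symm (P.next.symm d))) = 1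

/-- Strong labelings of a quadrangulation. In the proper 2-coloring `c` of the vertices, `true`
means white and `false` means black. -/
structure IsStrongLabeling (c : G.Coloring Bool) (s : Fin 2 → V) (B : AngleLabeling G) :
    Prop where
  special_black : ∀ i, c (s i) = false
  special : P.SpecialVertices s B
  vertex : P.VertexRule s B
  edge : P.EdgeRule B
  face : P.QuadFaceRule s B

/-- (G3⁺): each face has exactly one pair of adjacent 0-labels and exactly one pair of adjacent
1-labels, and the edge at `s 0` which has the outer face on its right when traversed from its
white end to its black end has two adjacent labels 0 in the outer face. -/
def StrongFaceRule (c : G.Coloring Bool) (s : Fin 2 → V) (B : AngleLabeling G) : Prop :=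
  (∀ (F : P.Face) (i : Fin 2),
    ∃! d : G.Dart, P.faceRight d = F ∧ B d = i ∧ B (P.next d) = i) ∧
  ∃ d : G.Dart, P.faceRight d = P.outer ∧ (d.fst = s 0 ∨ d.snd = s 0) ∧ c d.fst = true ∧
    B d = 0 ∧ B (P.next d) = 0

/-- (G2⁺), the six edge patterns (three shapes, each with `i = 0` and `i = 1`), for every edge
traversed by `d` from its white end to its black end:
* directed from white to black with color `i`,
* directed from black to white with color `i`,
* bidirected. -/
def ExtendedEdgeRule (c : G.Coloring Bool) (B : AngleLabeling G) : Prop :=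
  ∀ d : G.Dart, c d.fst = true → ∃ i : Fin 2,
    let M := P.toSphericalEmbedding
    (B.tailLeft M d = 1 - i ∧ B.tailRight M d = i ∧ B.headLeft M d = i ∧ B.headRight M d = i) ∨
    (B.tailLeft M d = i ∧ B.tailRight M d = i ∧ B.headLeft M d = 1 - i ∧ B.headRight M d = i) ∨
    (B.tailLeft M d = 1 - i ∧ B.tailRight M d = i ∧ B.headLeft M d = i ∧ B.headRight M d = 1 - i)

/-- Generalized strong labelings of a bipartite plane graph with white class `c = true` and black
class `c = false`. -/
structure IsGeneralizedStrongLabeling (c : G.Coloring Bool) (s : Fin 2 → V)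
    (B : AngleLabeling G) : Prop where
  special : P.SpecialVertices s B
  vertex : P.VertexRule s B
  edge : P.ExtendedEdgeRule c B
  face : P.StrongFaceRule c s B

/-- The dart `d` is a unidirected edge of color `i`: the labels at its tail differ, the two labels
at its head are both `i`. -/
def IsUnidirected (B : AngleLabeling G) (i : Fin 2) (d : G.Dart) : Prop :=
  B.tailLeft P.toSphericalEmbedding d ≠ B.tailRight P.toSphericalEmbedding d ∧
  B.headLeft P.toSphericalEmbedding d = i ∧ B.headRight P.toSphericalEmbedding d = i

/-- The dart `d` is one of the two directions of a bidirected edge (the labels differ at both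
ends), and this direction has color `i`: the label at the tail of `d`, on the side that is the
right side when the edge is traversed from white to black, is `i`. -/
def IsBidirected (c : G.Coloring Bool) (B : AngleLabeling G) (i : Fin 2) (d : G.Dart) : Prop :=
  B.tailLeft P.toSphericalEmbedding d ≠ B.tailRight P.toSphericalEmbedding d ∧
  B.headLeft P.toSphericalEmbedding d ≠ B.headRight P.toSphericalEmbedding d ∧
  (c d.fst = true → B.tailRight P.toSphericalEmbedding d = i) ∧
  (c d.fst = false → B.tailLeft P.toSphericalEmbedding d = i)

/-- `T_i` for a strong labeling of a quadrangulation, as a relation: there is an edge of color `i`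
directed from `u` to `v`. -/
def StrongT (B : AngleLabeling G) (i : Fin 2) (u v : V) : Prop :=
  ∃ d : G.Dart, d.fst = u ∧ d.snd = v ∧ P.IsUnidirected B i d

/-- `T_i` for a generalized strong labeling; a bidirected edge contributes one of its directions
to each of `T_0` and `T_1`. -/
def GeneralizedT (c : G.Coloring Bool) (B : AngleLabeling G) (i : Fin 2) (u v : V) : Prop :=
  ∃ d : G.Dart, d.fst = u ∧ d.snd = v ∧ (P.IsUnidirected B i d ∨ P.IsBidirected c B i d)

end PlaneGraph

/-- There is no directed cycle in the digraph `R`. -/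
def DigraphAcyclic {V : Type*} (R : V → V → Prop) : Prop := ∀ v, ¬ Relation.TransGen R v v

/-- The union of the digraph `R` with the reversal of the digraph `R'`. -/
def UnionReverse {V : Type*} (R R' : V → V → Prop) (u v : V) : Prop := R u v ∨ R' v u

/-- The digraph `R` is a directed tree with vertex set `S` and sink `r`: the underlying graph is a
tree on `S`, each of its edges has only one direction, and all edges are directed towards `r`. -/
structure IsDirectedTree {V : Type*} (R : V → V → Prop) (S : Set V) (r : V) : Prop where
  mem_of_arc : ∀ u v, R u v → u ∈ S ∧ v ∈ S
  arc_asymm : ∀ u v, R u v → ¬ R v u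
  tree : ((SimpleGraph.fromRel R).induce S).IsTree
  root_mem : r ∈ S
  sink : ∀ v, ¬ R r v
  path_to_sink : ∀ v ∈ S, Relation.ReflTransGen R v r

/-! Keep the arcs of color 0 and reverse those of color 1; the two directions of a bidirected edge
then agree, so `T_0 ∪ T_1⁻¹` lies in a single orientation of the edges. Everything rests on its
acyclicity (`IsBipolar.acyclic`). `T_1 ∪ T_0⁻¹` is the reversal of `T_0 ∪ T_1⁻¹`. The two label
changes around a non-special vertex give one outgoing arc of each color, so each `T_i` is acyclic
with out-degree one on its vertex set away from the sink, hence a tree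
(`IsDirectedTree.of_existsUnique`).

The label rules say that the orientation changes at most twice around each vertex, never around `s
0` and `s 1`, and at most twice around each face, while every angle is a change of exactly one of
these kinds. A directed cycle yields a set of faces with coherently oriented boundary
(`exists_positiveBoundary`); after passing to the complement if necessary and to a component, it is
a dually connected set `S` that contains the outer face and misses some face. Let `E` count the
edges with both sides in `S`, `b` the boundary edges, and `U` the vertices with all angles in `S`.
Then `S` has `2E + b` angles. At most `2|S|` are face changes and at most `2|U| + b - 4` are vertex
changes, the `4` being saved at the special vertices. Hence `E + 2 ≤ |U| + |S|`, against `|U| + |S|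
≤ E + 1` from `region_rank`.

Linear algebra replaces the Jordan curve theorem: gradients of vertex functions are orthogonal to
differences of face functions. A strong labeling of a quadrangulation is a generalized one without
bidirected edges. -/

/-! ### Orthogonal subspaces and dimension -/

/-- Each range lies in the orthogonal complement of the other, and fills it when the dimensions add
up to the whole. -/
theorem sum_mul_eq_zero_finrank {ι A A' : Type*} [Fintype ι] [AddCommGroup A] [Module ℝ A]
    [AddCommGroup A'] [Module ℝ A'] (α : A →ₗ[ℝ] (ι → ℝ)) (β : A' →ₗ[ℝ] (ι → ℝ))
    (horth : ∀ a b, ∑ i, α a i * β b i = 0) :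
    Module.finrank ℝ (LinearMap.range α) + Module.finrank ℝ (LinearMap.range β)
        ≤ Fintype.card ι ∧
      (Fintype.card ι ≤
          Module.finrank ℝ (LinearMap.range α) + Module.finrank ℝ (LinearMap.range β) →
        ∀ x : ι → ℝ, (∀ a, ∑ i, α a i * x i = 0) → ∃ b, β b = x) := by
  set e := (WithLp.linearEquiv 2 ℝ (ι → ℝ)).symm
  have he : ∀ x y : ι → ℝ, inner ℝ (e x) (e y) = ∑ i, x i * y i := by
    intro x y
    simp [e, PiLp.inner_apply, mul_comm]
  set U : Submodule ℝ (EuclideanSpace ℝ ι) := (LinearMap.range α).map e.toLinearMap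
  set W : Submodule ℝ (EuclideanSpace ℝ ι) := (LinearMap.range β).map e.toLinearMap
  have hU : Module.finrank ℝ U = Module.finrank ℝ (LinearMap.range α) :=
    LinearEquiv.finrank_map_eq e _
  have hW : Module.finrank ℝ W = Module.finrank ℝ (LinearMap.range β) :=
    LinearEquiv.finrank_map_eq e _
  have hmem : ∀ x : ι → ℝ, (∀ a, ∑ i, α a i * x i = 0) → e x ∈ Uᗮ := by
    intro x hx
    rw [Submodule.mem_orthogonal]
    rintro _ ⟨_, ⟨a, rfl⟩, rfl⟩
    exact (he _ _).trans (hx a)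
  have hle : W ≤ Uᗮ := by
    rintro _ ⟨_, ⟨b, rfl⟩, rfl⟩
    exact hmem _ fun a => horth a b
  have hsum := U.finrank_add_finrank_orthogonal
  rw [finrank_euclideanSpace] at hsum
  have hfin := Submodule.finrank_mono hle
  refine ⟨by omega, fun h x hx => ?_⟩
  have heq : W = Uᗮ := Submodule.eq_of_le_of_finrank_le hle (by omega)
  have hxW : e x ∈ W := heq ▸ hmem x hx
  obtain ⟨_, ⟨b, rfl⟩, hb⟩ := hxW
  exact ⟨b, e.injective hb⟩

/-! ### Darts and faces of the embedding -/

namespace SphericalEmbedding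

variable {V : Type*} {G : SimpleGraph V} (M : SphericalEmbedding G)

theorem rot_fst (d : G.Dart) : (M.rot d).fst = d.fst :=
  (M.rot_sameCycle_iff _ _).1 ((Equiv.Perm.SameCycle.refl _ _).apply_left)

theorem rot_symm_fst (d : G.Dart) : (M.rot.symm d).fst = d.fst := by
  rw [← M.rot_fst, Equiv.apply_symm_apply]

theorem next_fst (d : G.Dart) : (M.next d).fst = d.snd := by
  rw [M.next_apply, M.rot_fst]
  rfl

theorem faceRight_eq_iff (d e : G.Dart) :
    M.faceRight d = M.faceRight e ↔ M.next.SameCycle d e :=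
  Quotient.eq (r := Equiv.Perm.SameCycle.setoid M.next)

theorem faceRight_next (d : G.Dart) : M.faceRight (M.next d) = M.faceRight d :=
  (M.faceRight_eq_iff _ _).2 ((Equiv.Perm.SameCycle.refl _ _).apply_left)

theorem faceRight_rot (d : G.Dart) : M.faceRight (M.rot d) = M.faceRight d.symm := by
  rw [← M.faceRight_next d.symm, M.next_apply, SimpleGraph.Dart.symm_symm]

theorem exists_faceRight_eq (F : M.Face) : ∃ d, M.faceRight d = F :=
  Quotient.exists_rep F

instance [Finite V] : Finite G.Dart := by
  classical
  have := Fintype.ofFinite V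
  infer_instance

instance [Finite V] : Finite M.Face :=
  Finite.of_surjective M.faceRight M.exists_faceRight_eq

section Induction

variable [Finite V]

theorem rot_induction {p : G.Dart → Prop} (h : ∀ d, p d → p (M.rot d)) {d e : G.Dart}
    (hde : d.fst = e.fst) (hd : p d) : p e := by
  obtain ⟨n, -, -, rfl⟩ := ((M.rot_sameCycle_iff d e).2 hde).exists_pow_eq''
  clear hde
  induction n with
  | zero => exact hd
  | succ n ih =>
    rw [pow_succ']
    exact h _ ih

/-- Connectedness of `G`: rotations and reversals act transitively on the darts. -/
theorem dart_induction {p : G.Dart → Prop} (hrot : ∀ d, p d → p (M.rot d))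
    (hsymm : ∀ d, p d → p d.symm) {d : G.Dart} (hd : p d) (e : G.Dart) : p e := by
  have key : ∀ u v : V, G.Walk u v → (∀ d : G.Dart, d.fst = u → p d) →
      ∀ d : G.Dart, d.fst = v → p d := by
    intro u v w
    induction w with
    | nil => exact id
    | @cons u v w h q ih =>
      intro hu
      refine ih fun d hd => ?_
      have h1 : p (⟨(u, v), h⟩ : G.Dart).symm := hsymm _ (hu _ rfl)
      exact M.rot_induction hrot hd.symm h1
  obtain ⟨w⟩ := M.connected.preconnected d.fst e.fst
  exact key _ _ w (fun d' hd' => M.rot_induction hrot hd'.symm hd) e rfl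

theorem face_induction {p : M.Face → Prop}
    (h : ∀ d, p (M.faceRight d) → p (M.faceRight d.symm)) {F : M.Face} (hF : p F)
    (F' : M.Face) : p F' := by
  obtain ⟨d, rfl⟩ := M.exists_faceRight_eq F
  obtain ⟨e, rfl⟩ := M.exists_faceRight_eq F'
  refine M.dart_induction (p := fun d => p (M.faceRight d)) (fun d hd => ?_) h hF e
  rw [M.faceRight_rot]
  exact h d hd

end Induction

/-! ### Vertex gradients and face potentials -/

section Rank

variable [Fintype G.Dart]

open Classical in
theorem two_mul_card_positive {o : G.Dart → Bool} (ho : ∀ d : G.Dart, o d.symm = !o d)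
    {p : G.Dart → Prop} (hp : ∀ d, p d → p d.symm) :
    2 * Nat.card {d // o d = true ∧ p d} = Nat.card {d // p d} := by
  simp only [Nat.card_eq_fintype_card]
  have h1 : Fintype.card {d // o d = true ∧ p d} = Fintype.card {d // o d = false ∧ p d} := by
    refine Fintype.card_congr
      { toFun := fun d => ⟨d.1.symm, by simp [ho, d.2.1], hp _ d.2.2⟩
        invFun := fun d => ⟨d.1.symm, by simp [ho, d.2.1], hp _ d.2.2⟩
        left_inv := fun d => by simp
        right_inv := fun d => by simp }
  have h2 : Fintype.card {d // p d} =
      Fintype.card {d // o d = true ∧ p d} + Fintype.card {d // o d = false ∧ p d} := by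
    simp only [Fintype.card_subtype]
    rw [← Finset.card_filter_add_card_filter_not (s := Finset.univ.filter p) (fun d => o d = true)]
    simp only [Finset.filter_filter, Bool.not_eq_true]
    congr 2 <;> ext d <;> simp [and_comm]
  omega

/-- The dual graph restricted to the set `S` of faces is connected. -/
def DualConnected (S : Set M.Face) : Prop :=
  S.Nonempty ∧ ∀ p : M.Face → Prop,
    (∀ d, M.faceRight d ∈ S → M.faceRight d.symm ∈ S →
      p (M.faceRight d) → p (M.faceRight d.symm)) →
    ∀ F ∈ S, ∀ F' ∈ S, p F → p F'

-- Summation by parts: the face to the left of `d` is the face to the right of `M.rot d`, so the sum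
-- over all darts around a fixed tail cancels, and each edge is counted there twice with equal
-- terms.
open Classical in
theorem sum_positive_eq_zero {o : G.Dart → Bool} (ho : ∀ d : G.Dart, o d.symm = !o d)
    (g : V → ℝ) (h : M.Face → ℝ) :
    ∑ d : G.Dart with o d = true,
      (g d.fst - g d.snd) * (h (M.faceRight d) - h (M.faceRight d.symm)) = 0 := by
  set T : G.Dart → ℝ := fun d =>
    (g d.fst - g d.snd) * (h (M.faceRight d) - h (M.faceRight d.symm)) with hT
  have hTs : ∀ d : G.Dart, T d.symm = T d := by
    intro d
    simp only [hT, SimpleGraph.Dart.symm_symm]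
    change (g d.snd - g d.fst) * _ = _
    ring
  have e1 : ∑ d : G.Dart with o d = false, T d = ∑ d : G.Dart with o d = true, T d := by
    refine Finset.sum_nbij' (fun d => d.symm) (fun d => d.symm) ?_ ?_ ?_ ?_ ?_ <;>
      simp +contextual [ho, hTs]
  have e2 : ∑ d : G.Dart, T d = 0 := by
    have e3 : ∑ d : G.Dart, g d.snd * (h (M.faceRight d) - h (M.faceRight d.symm)) =
        ∑ d : G.Dart, g d.fst * (h (M.faceRight d.symm) - h (M.faceRight d)) := by
      refine Finset.sum_nbij' (fun d => d.symm) (fun d => d.symm) ?_ ?_ ?_ ?_ ?_ <;> simp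
    have e4 : ∑ d : G.Dart, g d.fst * h (M.faceRight d.symm) =
        ∑ d : G.Dart, g d.fst * h (M.faceRight d) := by
      refine Fintype.sum_equiv M.rot _ _ fun d => ?_
      rw [M.rot_fst, M.faceRight_rot]
    simp only [hT, sub_mul, Finset.sum_sub_distrib]
    rw [e3]
    simp only [mul_sub, Finset.sum_sub_distrib]
    rw [e4]
    ring
  have e5 := Finset.sum_filter_add_sum_filter_not Finset.univ (fun d => o d = true) T
  simp only [Bool.not_eq_true] at e5
  rw [e1, e2] at e5
  linarith

/-- The edges between two faces of `S`, each represented by its dart that is positive for `o`. -/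
abbrev PositiveDart (o : G.Dart → Bool) (S : Set M.Face) : Type _ :=
  {d : G.Dart // o d = true ∧ M.faceRight d ∈ S ∧ M.faceRight d.symm ∈ S}

-- Functions on `U`, extended by zero, have gradients of rank `|U|`, as `G` is connected and `v₀`
-- lies outside `U`. Functions on `S` have differences of rank at least `|S| - 1`, as `S` is dually
-- connected. The two spaces are orthogonal. The inequality serves proper regions; the equality case
-- serves the whole sphere, where it turns circulations into face potentials.
open Classical in
theorem region_rank [Fintype V] [Fintype M.Face] {o : G.Dart → Bool}
    (ho : ∀ d : G.Dart, o d.symm = !o d)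
    {S : Set M.Face} (hS : M.DualConnected S) {U : Set V}
    (hU : ∀ d : G.Dart, d.fst ∈ U → M.faceRight d ∈ S) {v₀ : V} (hv₀ : v₀ ∉ U) :
    Nat.card U + Nat.card S ≤
        Nat.card (M.PositiveDart o S) + 1 ∧
      (Nat.card (M.PositiveDart o S) + 1 ≤
          Nat.card U + Nat.card S →
        ∀ x : M.PositiveDart o S → ℝ,
          (∀ g : V → ℝ, ∑ d, (g d.1.fst - g d.1.snd) * x d = 0) →
          ∃ h : M.Face → ℝ, ∀ d, x d = h (M.faceRight d.1) - h (M.faceRight d.1.symm)) := by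
  simp only [Nat.card_eq_fintype_card]
  let extV : (U → ℝ) → V → ℝ := fun g v => if hv : v ∈ U then g ⟨v, hv⟩ else 0
  let extF : (S → ℝ) → M.Face → ℝ := fun h F => if hF : F ∈ S then h ⟨F, hF⟩ else 0
  have hsymm : ∀ d : G.Dart, d.fst ∈ U → M.faceRight d.symm ∈ S := by
    intro d hd
    rw [← M.faceRight_rot]
    exact hU _ (by rwa [M.rot_fst])
  -- An edge that does not have both sides in `S` has no endpoint in `U`, so restricting to
  -- `PositiveDart` loses nothing.
  have hout : ∀ (g : U → ℝ) (d : G.Dart), ¬ (M.faceRight d ∈ S ∧ M.faceRight d.symm ∈ S) →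
      extV g d.fst = 0 ∧ extV g d.snd = 0 := by
    intro g d hd
    constructor
    · refine dif_neg fun h => hd ⟨hU d h, hsymm d h⟩
    · refine dif_neg fun h => hd ⟨?_, hU d.symm h⟩
      simpa using hsymm d.symm h
  let α : (U → ℝ) →ₗ[ℝ] (M.PositiveDart o S → ℝ) :=
    { toFun := fun g d => extV g d.1.fst - extV g d.1.snd
      map_add' := fun g g' => by
        funext d
        simp only [extV, Pi.add_apply]
        split_ifs <;> ring
      map_smul' := fun a g => by
        funext d
        simp only [extV, Pi.smul_apply, smul_eq_mul, RingHom.id_apply]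
        split_ifs <;> ring }
  let β : (S → ℝ) →ₗ[ℝ] (M.PositiveDart o S → ℝ) :=
    { toFun := fun h d => h ⟨_, d.2.2.1⟩ - h ⟨_, d.2.2.2⟩
      map_add' := fun g g' => by
        funext d
        simp only [Pi.add_apply]
        ring
      map_smul' := fun a g => by
        funext d
        simp only [Pi.smul_apply, smul_eq_mul, RingHom.id_apply]
        ring }
  have hβ : ∀ h d, β h d = extF h (M.faceRight d.1) - extF h (M.faceRight d.1.symm) := by
    intro h d
    simp only [extF, dif_pos d.2.2.1, dif_pos d.2.2.2]
    rfl
  have horth : ∀ g h, ∑ d, α g d * β h d = 0 := by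
    intro g h
    rw [← M.sum_positive_eq_zero ho (extV g) (extF h)]
    simp only [hβ]
    change ∑ d : M.PositiveDart o S, (extV g d.1.fst - extV g d.1.snd) *
      (extF h (M.faceRight d.1) - extF h (M.faceRight d.1.symm)) = _
    rw [← Finset.sum_subtype (Finset.univ.filter fun d : G.Dart => o d = true ∧
      M.faceRight d ∈ S ∧ M.faceRight d.symm ∈ S) (by simp)
      (fun d => (extV g d.fst - extV g d.snd) *
        (extF h (M.faceRight d) - extF h (M.faceRight d.symm)))]
    refine Finset.sum_subset (fun d => by simp +contextual) fun d hd hd' => ?_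
    simp only [Finset.mem_filter, Finset.mem_univ, true_and] at hd hd'
    obtain ⟨h1, h2⟩ := hout g d fun h => hd' ⟨hd, h⟩
    rw [h1, h2, sub_zero, zero_mul]
  have hα : LinearMap.ker α = ⊥ := by
    rw [LinearMap.ker_eq_bot']
    intro g hg
    have h0 : ∀ d : G.Dart, extV g d.fst = extV g d.snd := by
      intro d
      by_cases hd : M.faceRight d ∈ S ∧ M.faceRight d.symm ∈ S
      · cases hod : o d
        · have := congrFun hg ⟨d.symm, by simp [ho, hod], hd.2, by simpa using hd.1⟩
          exact (sub_eq_zero.1 this).symm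
        · have := congrFun hg ⟨d, hod, hd⟩
          exact sub_eq_zero.1 this
      · rw [(hout g d hd).1, (hout g d hd).2]
    have h1 : ∀ u v, G.Walk u v → extV g u = extV g v := by
      intro u v w
      induction w with
      | nil => rfl
      | cons h q ih => exact (h0 ⟨(_, _), h⟩).trans ih
    funext ⟨v, hv⟩
    obtain ⟨w⟩ := M.connected.preconnected v v₀
    have := h1 _ _ w
    simpa [extV, hv, hv₀] using this
  have hker : Module.finrank ℝ (LinearMap.ker β) ≤ 1 := by
    obtain ⟨⟨F₀, hF₀⟩, hind⟩ := hS
    refine finrank_le_one ⟨fun _ => 1, ?_⟩ ?_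
    · rw [LinearMap.mem_ker]
      funext d
      exact sub_self _
    · rintro ⟨h, hh⟩
      refine ⟨extF h F₀, Subtype.ext ?_⟩
      funext ⟨F, hF⟩
      have := hind (fun F => extF h F = extF h F₀) ?_ F₀ hF₀ F hF rfl
      · simp only [extF, dif_pos hF] at this
        simp only [SetLike.mk_smul_mk, Pi.smul_apply, smul_eq_mul, mul_one]
        exact this.symm
      · intro d hd hd' h1
        rw [← h1]
        cases hod : o d
        · have := congrFun (LinearMap.mem_ker.1 hh)
            ⟨d.symm, by simp [ho, hod], hd', by simpa using hd⟩
          rw [hβ] at this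
          simpa using sub_eq_zero.1 this
        · have := congrFun (LinearMap.mem_ker.1 hh) ⟨d, hod, hd, hd'⟩
          rw [hβ] at this
          exact (sub_eq_zero.1 this).symm
  have rα := α.finrank_range_add_finrank_ker
  have rβ := β.finrank_range_add_finrank_ker
  rw [hα, finrank_bot, Module.finrank_fintype_fun_eq_card] at rα
  rw [Module.finrank_fintype_fun_eq_card] at rβ
  obtain ⟨k1, k2⟩ := sum_mul_eq_zero_finrank α β horth
  refine ⟨by omega, fun h x hx => ?_⟩
  obtain ⟨b, rfl⟩ := k2 (by omega) x fun g => hx (extV g)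
  exact ⟨extF b, hβ b⟩

end Rank

end SphericalEmbedding

/-! ### From directed cycles to regions of faces -/

namespace SphericalEmbedding

variable {V : Type*} {G : SimpleGraph V} (M : SphericalEmbedding G)

-- Counting the passages of a directed walk through each dart gives a unit flow from `u` to `v`, a
-- circulation when `u = v`.
open Classical in
theorem exists_circulation [Fintype G.Dart] {o : G.Dart → Bool} {u v : V}
    (h : Relation.TransGen (fun u v => ∃ d : G.Dart, d.fst = u ∧ d.snd = v ∧ o d = true) u v) :
    ∃ c : G.Dart → ℝ, (∀ d, 0 ≤ c d) ∧ (∀ d, o d = false → c d = 0) ∧ (∃ d, 0 < c d) ∧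
      ∀ g : V → ℝ, ∑ d, (g d.fst - g d.snd) * c d = g u - g v := by
  have single : ∀ d : G.Dart, o d = true →
      (∀ e, 0 ≤ (Pi.single d 1 : G.Dart → ℝ) e) ∧
      (∀ e, o e = false → (Pi.single d 1 : G.Dart → ℝ) e = 0) ∧
      (∃ e, 0 < (Pi.single d 1 : G.Dart → ℝ) e) ∧
      ∀ g : V → ℝ, ∑ e : G.Dart, (g e.fst - g e.snd) * (Pi.single d 1 : G.Dart → ℝ) e =
        g d.fst - g d.snd := by
    intro d hd
    refine ⟨fun e => ?_, fun e he => ?_, ⟨d, by simp⟩, fun g => ?_⟩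
    · by_cases hed : e = d
      · subst hed
        simp
      · simp [Pi.single_eq_of_ne hed]
    · refine Pi.single_eq_of_ne ?_ _
      rintro rfl
      simp [hd] at he
    · rw [Finset.sum_eq_single d] <;> simp +contextual
  induction h with
  | single h =>
    obtain ⟨d, rfl, rfl, hd⟩ := h
    exact ⟨_, single d hd⟩
  | tail _ h ih =>
    obtain ⟨d, rfl, rfl, hd⟩ := h
    obtain ⟨c, h1, h2, ⟨e, h3⟩, h4⟩ := ih
    obtain ⟨k1, k2, -, k4⟩ := single d hd
    refine ⟨c + Pi.single d 1, fun d => add_nonneg (h1 d) (k1 d), fun d hd => ?_,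
      ⟨e, add_pos_of_pos_of_nonneg h3 (k1 e)⟩, fun g => ?_⟩
    · rw [Pi.add_apply, h2 d hd, k2 d hd, add_zero]
    · simp only [Pi.add_apply, mul_add, Finset.sum_add_distrib]
      rw [h4, k4]
      ring

/-- All boundary darts of the region `S` that have `S` on their right are positive for `o`. -/
def PositiveBoundary (o : G.Dart → Bool) (S : Set M.Face) : Prop :=
  ∀ d, M.faceRight d ∈ S → M.faceRight d.symm ∉ S → o d = true

theorem dualConnected_univ [Finite V] (F₀ : M.Face) : M.DualConnected Set.univ :=
  ⟨⟨F₀, trivial⟩, fun _ h _ _ F' _ hF =>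
    M.face_induction (fun d => h d trivial trivial) hF F'⟩

/-- Euler's formula is the equality case of `region_rank` for all faces and all vertices but `v`, so
the circulation of the cycle is the difference of a face potential `f`. Flow being nonnegative along
positive darts, `f` can only drop from right to left of such a dart; so the boundary of any
superlevel set is positive. -/
theorem exists_positiveBoundary [Finite V] {o : G.Dart → Bool}
    (ho : ∀ d : G.Dart, o d.symm = !o d) {v : V}
    (h : Relation.TransGen (fun u v => ∃ d : G.Dart, d.fst = u ∧ d.snd = v ∧ o d = true) v v) :
    ∃ S : Set M.Face, M.PositiveBoundary o S ∧
      ∃ d, M.faceRight d ∈ S ∧ M.faceRight d.symm ∉ S := by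
  classical
  have := Fintype.ofFinite V
  have := Fintype.ofFinite G.Dart
  have := Fintype.ofFinite M.Face
  obtain ⟨c, hc, hc0, ⟨d₀, hd₀⟩, hg⟩ := exists_circulation h
  obtain ⟨-, hex⟩ := M.region_rank ho (M.dualConnected_univ (M.faceRight d₀))
    (U := {u | u ≠ v}) (fun _ _ => trivial) (v₀ := v) (by simp)
  have hcard : Nat.card (M.PositiveDart o Set.univ) + 1 ≤
      Nat.card {u | u ≠ v} + Nat.card (Set.univ : Set M.Face) := by
    have h1 := M.euler
    change Nat.card V + Nat.card M.Face = _ at h1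
    have h2 : 2 * Nat.card (M.PositiveDart o Set.univ) = _ :=
      two_mul_card_positive ho (p := fun d => M.faceRight d ∈ Set.univ ∧
        M.faceRight d.symm ∈ Set.univ) (fun _ _ => ⟨trivial, trivial⟩)
    have h3 : Nat.card {d // M.faceRight d ∈ Set.univ ∧ M.faceRight d.symm ∈ Set.univ} =
        Nat.card G.Dart :=
      Nat.card_congr (Equiv.subtypeUnivEquiv fun _ => ⟨trivial, trivial⟩)
    have h4 : Nat.card G.Dart = 2 * Nat.card G.edgeSet := by
      rw [Nat.card_eq_fintype_card, Nat.card_eq_fintype_card, ← SimpleGraph.edgeFinset_card,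
        ← G.dart_card_eq_twice_card_edges]
      convert rfl
    have h5 : Nat.card {u | u ≠ v} = Nat.card V - 1 := by
      rw [Nat.card_coe_set_eq, show {u | u ≠ v} = {v}ᶜ from rfl, Set.ncard_compl,
        Set.ncard_singleton]
    have h6 : 0 < Nat.card V := Nat.card_pos_iff.2 ⟨⟨v⟩, inferInstance⟩
    have h7 : Nat.card (Set.univ : Set M.Face) = Nat.card M.Face := by simp
    omega
  obtain ⟨f, hf⟩ := hex hcard (fun d => c d.1) fun g => by
    rw [← sub_self (g v), ← hg g, ← Finset.sum_subtype (Finset.univ.filter fun d : G.Dart =>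
      o d = true ∧ M.faceRight d ∈ Set.univ ∧ M.faceRight d.symm ∈ Set.univ) (by simp)
      (fun d : G.Dart => (g d.fst - g d.snd) * c d)]
    refine Finset.sum_subset (Finset.subset_univ _) fun d _ hd => ?_
    rw [hc0 d (by simpa using hd), mul_zero]
  have hf' : ∀ d, o d = true → c d = f (M.faceRight d) - f (M.faceRight d.symm) :=
    fun d hd => hf ⟨d, hd, trivial, trivial⟩
  have hod₀ : o d₀ = true := by
    by_contra hn
    rw [hc0 d₀ (by simpa using hn)] at hd₀
    exact lt_irrefl _ hd₀
  -- The threshold is the value just left of a dart carrying flow, which puts that dart on the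
  -- boundary.
  refine ⟨{F | f (M.faceRight d₀.symm) < f F}, fun d h1 h2 => ?_, d₀, ?_, ?_⟩
  · by_contra hn
    have h3 := hf' d.symm (by simp [ho, hn])
    have h4 := hc d.symm
    rw [SimpleGraph.Dart.symm_symm] at h3
    simp only [Set.mem_ofPred_eq] at h1 h2
    linarith
  · have := hf' d₀ hod₀
    simp only [Set.mem_ofPred_eq]
    linarith
  · simp

/-- The faces of `S` that are connected to `F₀` in the dual graph restricted to `S`. -/
def dualComponent (S : Set M.Face) (F₀ : M.Face) : Set M.Face :=
  {F | Relation.ReflTransGen (fun F F' => F' ∈ S ∧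
    ∃ d, M.faceRight d = F ∧ M.faceRight d.symm = F') F₀ F}

theorem dualConnected_dualComponent (S : Set M.Face) (F₀ : M.Face) :
    M.DualConnected (M.dualComponent S F₀) := by
  refine ⟨⟨F₀, Relation.ReflTransGen.refl⟩, fun p hp => ?_⟩
  have key : ∀ F ∈ M.dualComponent S F₀, p F ↔ p F₀ := by
    intro F hF
    induction hF with
    | refl => exact Iff.rfl
    | tail h1 h2 ih =>
      have h3 := Relation.ReflTransGen.tail h1 h2
      obtain ⟨-, d, rfl, rfl⟩ := h2
      rw [← ih]
      refine ⟨fun h => ?_, hp d h1 h3⟩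
      have h4 := hp d.symm h3
      rw [SimpleGraph.Dart.symm_symm] at h4
      exact h4 h1 h
  intro F hF F' hF' h
  rwa [key F' hF', ← key F hF]

theorem dualComponent_subset {S : Set M.Face} {F₀ : M.Face} (h₀ : F₀ ∈ S) :
    M.dualComponent S F₀ ⊆ S := by
  intro F hF
  cases hF with
  | refl => exact h₀
  | tail _ h => exact h.1

theorem PositiveBoundary.dualComponent {o : G.Dart → Bool} {S : Set M.Face}
    (h : M.PositiveBoundary o S) {F₀ : M.Face} (h₀ : F₀ ∈ S) :
    M.PositiveBoundary o (M.dualComponent S F₀) := fun d hd hd' =>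
  h d (M.dualComponent_subset h₀ hd) fun hS =>
    hd' (Relation.ReflTransGen.tail hd ⟨hS, d, rfl, rfl⟩)

theorem exists_exit [Finite V] {S : Set M.Face} {d e : G.Dart} (hde : d.fst = e.fst)
    (hd : M.faceRight d ∈ S) (he : M.faceRight e ∉ S) :
    ∃ x : G.Dart, x.fst = d.fst ∧ M.faceRight x ∈ S ∧ M.faceRight x.symm ∉ S := by
  by_contra! H
  refine he (M.rot_induction (p := fun y => y.fst = d.fst ∧ M.faceRight y ∈ S)
    (fun y hy => ⟨by rw [M.rot_fst, hy.1], ?_⟩) hde ⟨rfl, hd⟩).2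
  rw [M.faceRight_rot]
  exact H y hy.1 hy.2

/-- Turning counterclockwise, `S` is left across a positive dart. Without a change at the angles
outside `S` the darts stay positive, whereas a dart across which `S` is reentered must be negative.
-/
theorem PositiveBoundary.exists_alternation [Finite V] {o : G.Dart → Bool}
    (ho : ∀ d : G.Dart, o d.symm = !o d) {S : Set M.Face} (hS : M.PositiveBoundary o S)
    {d e : G.Dart} (hde : d.fst = e.fst) (hd : M.faceRight d ∈ S) (he : M.faceRight e ∉ S) :
    ∃ a : G.Dart, a.fst = d.fst ∧ M.faceRight a ∉ S ∧ o (M.rot.symm a) ≠ o a := by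
  obtain ⟨x, hx, hxS, hxS'⟩ := M.exists_exit hde hd he
  by_contra! H
  have key := M.rot_induction
    (p := fun y => y.fst = d.fst ∧ o y = true ∧ M.faceRight (M.rot y) ∉ S)
    (fun y hy => ?_) (d := x) (e := M.rot.symm d) (by rw [M.rot_symm_fst, hx])
    ⟨hx, hS x hxS hxS', by rwa [M.faceRight_rot]⟩
  · rw [Equiv.apply_symm_apply] at key
    exact key.2.2 hd
  · obtain ⟨h1, h2, h3⟩ := hy
    have h4 : o (M.rot y) = true := by
      rw [← H (M.rot y) (by rw [M.rot_fst, h1]) h3, Equiv.symm_apply_apply, h2]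
    refine ⟨by rw [M.rot_fst, h1], h4, fun h5 => ?_⟩
    rw [M.faceRight_rot] at h5
    have h6 := hS (M.rot y).symm h5 (by rwa [SimpleGraph.Dart.symm_symm])
    rw [ho, h4] at h6
    simp at h6

/-! ### Acyclicity of bipolar orientations by counting angles -/

/-- `o` orients every edge (the positive dart being the direction) such that around each vertex and
around each face the orientation alternates at most twice, and not at all around the two vertices
`s 0` and `s 1` of the face `F₀`. The angle at `d.fst` on the right of `d` is between `d` and
`M.rot.symm d`; it belongs to an alternation either of its vertex or of its face. -/
structure IsBipolar (o : G.Dart → Bool) (s : Fin 2 → V) (F₀ : M.Face) : Prop where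
  symm : ∀ d : G.Dart, o d.symm = !o d
  special_ne : s 0 ≠ s 1
  special : ∀ (i : Fin 2) (d : G.Dart), d.fst = s i → o (M.rot.symm d) = o d
  outer : ∀ i : Fin 2, ∃ d : G.Dart, d.fst = s i ∧ M.faceRight d = F₀
  vertex : ∀ v, {d : G.Dart | d.fst = v ∧ o (M.rot.symm d) ≠ o d}.ncard ≤ 2
  face : ∀ F, {d : G.Dart | M.faceRight d = F ∧ o (M.rot.symm d) = o d}.ncard ≤ 2

variable {M} in
theorem IsBipolar.neg {o : G.Dart → Bool} {s : Fin 2 → V} {F₀ : M.Face}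
    (h : M.IsBipolar o s F₀) : M.IsBipolar (fun d => !o d) s F₀ where
  symm d := by rw [h.symm]
  special_ne := h.special_ne
  special i d hd := by rw [h.special i d hd]
  outer := h.outer
  vertex v := by simpa using h.vertex v
  face F := by simpa using h.face F

-- If `v` is interior to `S`, the bound is the one on alternations, with the `2` spare at a special
-- vertex. If `v` is on the boundary, it has a boundary dart and one of its at most two alternations
-- falls outside `S` by `exists_alternation`. A special vertex has no alternation but touches `F₀ ∈
-- S`, so it is interior.
variable {M} in
open Classical in
theorem IsBipolar.vertex_count [Fintype V] [Fintype G.Dart] {o : G.Dart → Bool}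
    {s : Fin 2 → V} {F₀ : M.Face} (h : M.IsBipolar o s F₀) {S : Set M.Face} (hF₀ : F₀ ∈ S)
    (hS : M.PositiveBoundary o S) (v : V) :
    (Finset.univ.filter fun d : G.Dart =>
        (M.faceRight d ∈ S ∧ o (M.rot.symm d) ≠ o d) ∧ d.fst = v).card +
      (if v = s 0 ∨ v = s 1 then 2 else 0) ≤
    (Finset.univ.filter fun d : G.Dart =>
        (M.faceRight d ∈ S ∧ M.faceRight d.symm ∉ S) ∧ d.fst = v).card +
      (if ∀ d : G.Dart, d.fst = v → M.faceRight d ∈ S then 2 else 0) := by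
  have hv := h.vertex v
  rw [Set.ncard_eq_toFinset_card', Set.toFinset_ofPred] at hv
  by_cases hU : ∀ d : G.Dart, d.fst = v → M.faceRight d ∈ S
  · rw [if_pos hU]
    split_ifs with hs
    · rw [Finset.card_eq_zero.2]
      · omega
      · refine Finset.filter_eq_empty_iff.2 fun d _ hd => hd.1.2 ?_
        rcases hs with hs | hs
        · exact h.special 0 d (hd.2.trans hs)
        · exact h.special 1 d (hd.2.trans hs)
    · have : (Finset.univ.filter fun d : G.Dart =>
        (M.faceRight d ∈ S ∧ o (M.rot.symm d) ≠ o d) ∧ d.fst = v).card ≤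
          (Finset.univ.filter fun d : G.Dart => d.fst = v ∧ o (M.rot.symm d) ≠ o d).card :=
        Finset.card_le_card (Finset.monotone_filter_right _ fun d _ hd => ⟨hd.2, hd.1.2⟩)
      omega
  · rw [if_neg hU]
    push Not at hU
    obtain ⟨e, he, heS⟩ := hU
    by_cases hd : ∃ d : G.Dart, d.fst = v ∧ M.faceRight d ∈ S
    · obtain ⟨d, hd, hdS⟩ := hd
      obtain ⟨x, hx, hxS⟩ := M.exists_exit (hd.trans he.symm) hdS heS
      obtain ⟨a, ha, haS, haa⟩ := hS.exists_alternation M h.symm (hd.trans he.symm) hdS heS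
      have hs : ¬ (v = s 0 ∨ v = s 1) := by
        rintro (hs | hs)
        · exact haa (h.special 0 a (ha.trans (hd.trans hs)))
        · exact haa (h.special 1 a (ha.trans (hd.trans hs)))
      rw [if_neg hs]
      have h1 : 0 < (Finset.univ.filter fun d : G.Dart =>
          (M.faceRight d ∈ S ∧ M.faceRight d.symm ∉ S) ∧ d.fst = v).card :=
        Finset.card_pos.2 ⟨x, by simpa using ⟨hxS, hx.trans hd⟩⟩
      have h2 : (Finset.univ.filter fun d : G.Dart =>
          (M.faceRight d ∈ S ∧ o (M.rot.symm d) ≠ o d) ∧ d.fst = v).card < _ :=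
        Finset.card_lt_card (t := Finset.univ.filter fun d : G.Dart =>
          d.fst = v ∧ o (M.rot.symm d) ≠ o d) (by
            rw [Finset.ssubset_iff_of_subset
              (Finset.monotone_filter_right _ fun d _ hd => ⟨hd.2, hd.1.2⟩)]
            exact ⟨a, by simpa using ⟨ha.trans hd, haa⟩, by simp [haS]⟩)
      omega
    · push Not at hd
      have hs : ¬ (v = s 0 ∨ v = s 1) := by
        rintro (hs | hs)
        · obtain ⟨d, h1, h2⟩ := h.outer 0
          exact hd d (h1.trans hs.symm) (h2 ▸ hF₀)
        · obtain ⟨d, h1, h2⟩ := h.outer 1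
          exact hd d (h1.trans hs.symm) (h2 ▸ hF₀)
      rw [if_neg hs, Finset.card_eq_zero.2]
      · omega
      · exact Finset.filter_eq_empty_iff.2 fun d _ hd' => hd d hd'.2 hd'.1.1

variable {M} in
theorem IsBipolar.not_positiveBoundary [Finite V] {o : G.Dart → Bool} {s : Fin 2 → V}
    {F₀ : M.Face} (h : M.IsBipolar o s F₀) {S : Set M.Face} (hF₀ : F₀ ∈ S)
    (hS : M.PositiveBoundary o S) (hconn : M.DualConnected S) {F₁ : M.Face} (hF₁ : F₁ ∉ S) :
    False := by
  classical
  have := Fintype.ofFinite V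
  have := Fintype.ofFinite G.Dart
  have := Fintype.ofFinite M.Face
  obtain ⟨v₀, hv₀⟩ : ∃ v₀, v₀ ∉ {v | ∀ d : G.Dart, d.fst = v → M.faceRight d ∈ S} := by
    obtain ⟨d, rfl⟩ := M.exists_faceRight_eq F₁
    exact ⟨d.fst, fun h => hF₁ (h d rfl)⟩
  have hrank := (M.region_rank h.symm hconn
    (U := {v | ∀ d : G.Dart, d.fst = v → M.faceRight d ∈ S}) (fun d hd => hd d rfl) hv₀).1
  have hpos : 2 * Nat.card (M.PositiveDart o S) = _ :=
    two_mul_card_positive h.symm (p := fun d => M.faceRight d ∈ S ∧ M.faceRight d.symm ∈ S)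
      (fun d hd => ⟨hd.2, by simpa using hd.1⟩)
  rw [Nat.card_eq_fintype_card (α := {d // M.faceRight d ∈ S ∧ M.faceRight d.symm ∈ S}),
    Fintype.card_subtype] at hpos
  -- The angles of `S` counted twice: `c1` by interior and boundary darts, `c2` by face and vertex
  -- alternations.
  have c1 := Finset.card_filter_add_card_filter_not
    (s := Finset.univ.filter fun d => M.faceRight d ∈ S) (fun d => M.faceRight d.symm ∈ S)
  have c2 := Finset.card_filter_add_card_filter_not
    (s := Finset.univ.filter fun d => M.faceRight d ∈ S) (fun d => o (M.rot.symm d) = o d)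
  simp only [Finset.filter_filter] at c1 c2
  have cf : (Finset.univ.filter fun d => M.faceRight d ∈ S ∧ o (M.rot.symm d) = o d).card ≤
      2 * Nat.card S := by
    rw [Finset.card_eq_sum_card_fiberwise (f := M.faceRight) (t := S.toFinset)
      (fun d hd => by simpa using (Finset.mem_filter.1 hd).2.1), mul_comm,
      Nat.card_eq_fintype_card, ← Set.toFinset_card, ← smul_eq_mul]
    refine Finset.sum_le_card_nsmul _ _ _ fun F _ => ?_
    refine le_trans ?_ (h.face F)
    rw [Set.ncard_eq_toFinset_card', Set.toFinset_ofPred, Finset.filter_filter]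
    exact Finset.card_le_card (Finset.monotone_filter_right _ fun d _ hd => ⟨hd.2, hd.1.2⟩)
  have cv := Finset.sum_le_sum fun v (_ : v ∈ Finset.univ) => h.vertex_count hF₀ hS v
  have hfib : ∀ (p : G.Dart → Prop) [DecidablePred p],
      ∑ v, (Finset.univ.filter fun d => p d ∧ d.fst = v).card =
      (Finset.univ.filter p).card := by
    intro p _
    rw [Finset.card_eq_sum_card_fiberwise (f := fun d : G.Dart => d.fst) (t := Finset.univ)
      (fun _ _ => Finset.mem_coe.2 (Finset.mem_univ _))]
    simp only [Finset.filter_filter]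
  have hsp : (Finset.univ.filter fun v => v = s 0 ∨ v = s 1).card = 2 := by
    refine Eq.trans (congrArg Finset.card ?_) (Finset.card_pair h.special_ne)
    ext v
    simp
  have hU : Nat.card {v | ∀ d : G.Dart, d.fst = v → M.faceRight d ∈ S} =
      (Finset.univ.filter fun v => ∀ d : G.Dart, d.fst = v → M.faceRight d ∈ S).card := by
    rw [Nat.card_eq_fintype_card, ← Set.toFinset_card, Set.toFinset_ofPred]
  simp only [Finset.sum_add_distrib, hfib, ← Finset.sum_filter, Finset.sum_const, smul_eq_mul,
    hsp] at cv
  simp only [ne_eq] at cv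
  omega

variable {M} in
theorem IsBipolar.acyclic [Finite V] {o : G.Dart → Bool} {s : Fin 2 → V} {F₀ : M.Face}
    (h : M.IsBipolar o s F₀) :
    DigraphAcyclic fun u v => ∃ d : G.Dart, d.fst = u ∧ d.snd = v ∧ o d = true := by
  intro v hv
  obtain ⟨S, hS, d, hd, hd'⟩ := M.exists_positiveBoundary h.symm hv
  by_cases hF₀ : F₀ ∈ S
  · exact h.not_positiveBoundary Relation.ReflTransGen.refl (hS.dualComponent M hF₀)
      (M.dualConnected_dualComponent S F₀) fun h' => hd' (M.dualComponent_subset hF₀ h')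
  · have hS' : M.PositiveBoundary (fun d => !o d) Sᶜ := by
      intro d hd hd'
      change (!o d) = true
      rw [← h.symm]
      exact hS d.symm (by simpa using hd') (by simpa using hd)
    refine h.neg.not_positiveBoundary Relation.ReflTransGen.refl (hS'.dualComponent M hF₀)
      (M.dualConnected_dualComponent Sᶜ F₀) (F₁ := M.faceRight d) fun h' => ?_
    exact (M.dualComponent_subset (S := Sᶜ) hF₀ h') hd

end SphericalEmbedding

/-! ### From labelings to bipolar orientations -/

theorem coloring_symm_fst {V : Type*} {G : SimpleGraph V} (c : G.Coloring Bool) (d : G.Dart) :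
    c d.symm.fst = !c d.fst := by
  have h : c d.fst ≠ c d.snd := c.valid d.adj
  change c d.snd = _
  revert h
  cases c d.fst <;> cases c d.snd <;> simp

namespace PlaneGraph

variable {V : Type*} {G : SimpleGraph V} {P : PlaneGraph G} {c : G.Coloring Bool}
  {s : Fin 2 → V} {B : AngleLabeling G}

variable (P c B) in
/-- The orientation of the edges in which those of color `0` keep their direction and those of
color `1` are reversed. -/
def bipolarDir (d : G.Dart) : Bool :=
  decide ((if c d.fst = true then B (P.rot d) else B d) = 1)

theorem bipolarDir_of_white {d : G.Dart} (hd : c d.fst = true) :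
    P.bipolarDir c B d = decide (B (P.rot d) = 1) := by
  rw [bipolarDir, if_pos hd]

theorem bipolarDir_of_black {d : G.Dart} (hd : c d.fst = false) :
    P.bipolarDir c B d = decide (B d = 1) := by
  rw [bipolarDir, if_neg (by simp [hd])]

/-- In a cyclic binary word the changes from 0 to 1 and from 1 to 0 are equally many. -/
theorem VertexRule.existsUnique [Finite V] (h : P.VertexRule s B) {v : V} (h₀ : v ≠ s 0)
    (h₁ : v ≠ s 1) (j : Fin 2) :
    ∃! d : G.Dart, d.fst = v ∧ B d = j ∧ B (P.rot d) = 1 - j := by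
  classical
  have := Fintype.ofFinite G.Dart
  have hup := h v h₀ h₁
  fin_cases j
  · exact hup
  · rw [Fintype.existsUnique_iff_card_one] at hup ⊢
    have e : (Finset.univ.filter fun d : G.Dart => d.fst = v ∧ B (P.rot d) = 1).card =
        (Finset.univ.filter fun d : G.Dart => d.fst = v ∧ B d = 1).card := by
      refine Finset.card_bij' (fun d _ => P.rot d) (fun d _ => P.rot.symm d) ?_ ?_ ?_ ?_ <;>
        simp +contextual [P.rot_fst, P.rot_symm_fst]
    have e1 := Finset.card_filter_add_card_filter_not
      (s := Finset.univ.filter fun d : G.Dart => d.fst = v ∧ B (P.rot d) = 1) (fun d => B d = 0)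
    have e2 := Finset.card_filter_add_card_filter_not
      (s := Finset.univ.filter fun d : G.Dart => d.fst = v ∧ B d = 1) (fun d => B (P.rot d) = 0)
    simp only [Finset.filter_filter] at e1 e2
    have two : ∀ i : Fin 2, ¬ i = 0 ↔ i = 1 := by decide
    have f1 : (Finset.univ.filter fun d : G.Dart => (d.fst = v ∧ B (P.rot d) = 1) ∧ B d = 0) =
        Finset.univ.filter fun d : G.Dart => d.fst = v ∧ B d = 0 ∧ B (P.rot d) = 1 := by
      ext d
      simp only [Finset.mem_filter]
      tauto
    have f2 : (Finset.univ.filter fun d : G.Dart => (d.fst = v ∧ B (P.rot d) = 1) ∧ ¬ B d = 0) =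
        Finset.univ.filter fun d : G.Dart => (d.fst = v ∧ B d = 1) ∧ ¬ B (P.rot d) = 0 := by
      ext d
      simp only [Finset.mem_filter, two]
      tauto
    rw [f1, f2, hup] at e1
    simp only [and_assoc] at e1 e2
    change (Finset.univ.filter fun d : G.Dart => d.fst = v ∧ B d = 1 ∧ B (P.rot d) = 0).card = 1
    omega

namespace IsGeneralizedStrongLabeling

/-- On the left of an edge traversed from white to black the two labels differ; on the right they
coincide if the labels at one of its ends coincide, which happens at one end at most. -/
theorem labels (h : P.IsGeneralizedStrongLabeling c s B) {d : G.Dart} (hd : c d.fst = true) :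
    B (P.rot d) ≠ B d.symm ∧
      (B d = B (P.rot d) → B d = B (P.rot d.symm) ∧ B d.symm ≠ B (P.rot d.symm)) ∧
      (B d.symm = B (P.rot d.symm) → B d = B (P.rot d.symm)) := by
  have key : ∀ wl wr bl br : Fin 2, (∃ i : Fin 2,
      (wl = 1 - i ∧ wr = i ∧ bl = i ∧ br = i) ∨ (wl = i ∧ wr = i ∧ bl = 1 - i ∧ br = i) ∨
      (wl = 1 - i ∧ wr = i ∧ bl = i ∧ br = 1 - i)) →
      wl ≠ bl ∧ (wr = wl → wr = br ∧ bl ≠ br) ∧ (bl = br → wr = br) := by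
    decide
  exact key _ _ _ _ (h.edge d hd)

theorem rot_symm_ne (h : P.IsGeneralizedStrongLabeling c s B) {d : G.Dart}
    (hd : c d.fst = false) : B (P.rot d.symm) ≠ B d := by
  have := (h.labels (d := d.symm) (by rw [coloring_symm_fst, hd]; rfl)).1
  rwa [SimpleGraph.Dart.symm_symm] at this

/-- Left of an edge traversed from white to black the labels differ, so its direction can be read
consistently at either end, and alternations around a vertex are label changes there. An alternation
around a face is a coincidence of labels at one end of an edge; this forces a pair of equal adjacent
labels in the face, and there are two such pairs. -/
theorem isBipolar [Finite V] (h : P.IsGeneralizedStrongLabeling c s B) :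
    P.IsBipolar (P.bipolarDir c B) s P.outer where
  symm d := by
    have key : ∀ i j : Fin 2, i ≠ j → decide (j = 1) = !decide (i = 1) := by decide
    cases hd : c d.fst
    · rw [bipolarDir_of_black hd, bipolarDir_of_white (by rw [coloring_symm_fst, hd]; rfl)]
      exact key _ _ (h.rot_symm_ne hd).symm
    · rw [bipolarDir_of_white hd, bipolarDir_of_black (by rw [coloring_symm_fst, hd]; rfl)]
      exact key _ _ (h.labels hd).1
  special_ne := h.special.1
  special i d hd := by
    have hB := (h.special.2 i).2
    have h1 := P.rot_symm_fst d
    have h2 := P.rot_fst d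
    unfold bipolarDir
    rw [h1, Equiv.apply_symm_apply, hB d hd, hB (P.rot d) (h2.trans hd),
      hB (P.rot.symm d) (h1.trans hd)]
  outer i := (h.special.2 i).1
  vertex v := by
    have hB : ∀ i d, d.fst = s i → B d = i := fun i => (h.special.2 i).2
    by_cases h₀ : v = s 0 ∨ v = s 1
    · obtain ⟨i, rfl⟩ : ∃ i, v = s i := by
        rcases h₀ with h₀ | h₀
        exacts [⟨0, h₀⟩, ⟨1, h₀⟩]
      refine (Set.ncard_eq_zero (Set.toFinite _)).2 ?_ |>.trans_le (Nat.zero_le 2)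
      · refine Set.eq_empty_iff_forall_notMem.2 fun d hd => hd.2 ?_
        have h1 := P.rot_symm_fst d
        have h2 := P.rot_fst d
        unfold bipolarDir
        rw [h1, Equiv.apply_symm_apply, hB i d hd.1, hB i (P.rot d) (h2.trans hd.1),
          hB i (P.rot.symm d) (h1.trans hd.1)]
    · push Not at h₀
      obtain ⟨x, -, hx⟩ := h.vertex.existsUnique h₀.1 h₀.2 0
      obtain ⟨y, -, hy⟩ := h.vertex.existsUnique h₀.1 h₀.2 1
      have key : ∀ d : G.Dart, d.fst = v → B d ≠ B (P.rot d) → d = x ∨ d = y := by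
        intro d hd hne
        have two : ∀ i j : Fin 2, i ≠ j → (i = 0 ∧ j = 1 - 0) ∨ (i = 1 ∧ j = 1 - 1) := by decide
        rcases two _ _ hne with h1 | h1
        · exact Or.inl (hx d ⟨hd, h1⟩)
        · exact Or.inr (hy d ⟨hd, h1⟩)
      -- At a black vertex the direction of `d` is read to the right of `d`, at a white one to its
      -- left; this shifts the alternations by one rotation.
      cases hv : c v
      · refine (Set.ncard_le_ncard (t := {P.rot x, P.rot y}) ?_).trans
          ((Set.ncard_insert_le _ _).trans (by simp))
        rintro d ⟨hd, hne⟩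
        have h1 := P.rot_symm_fst d
        rw [bipolarDir_of_black (by rw [h1, hd, hv]), bipolarDir_of_black (by rw [hd, hv])] at hne
        have := key (P.rot.symm d) (h1.trans hd) fun heq => hne (by
          rw [heq, Equiv.apply_symm_apply])
        simpa [Equiv.symm_apply_eq] using this
      · refine (Set.ncard_le_ncard (t := {x, y}) ?_).trans
          ((Set.ncard_insert_le _ _).trans (by simp))
        rintro d ⟨hd, hne⟩
        have h1 := P.rot_symm_fst d
        rw [bipolarDir_of_white (by rw [h1, hd, hv]), bipolarDir_of_white (by rw [hd, hv]),
          Equiv.apply_symm_apply] at hne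
        exact key d hd fun heq => hne (by rw [← heq])
  face F := by
    classical
    have dec : ∀ i j : Fin 2, decide (i = 1) = decide (j = 1) → i = j := by decide
    obtain ⟨x, -, hx⟩ := h.face.1 F 0
    obtain ⟨y, -, hy⟩ := h.face.1 F 1
    have hmono : ∀ w : G.Dart, P.faceRight w = F → B w = B (P.rot w.symm) → w = x ∨ w = y := by
      intro w hw hBw
      have two : ∀ i j : Fin 2, i = j → (i = 0 ∧ j = 0) ∨ (i = 1 ∧ j = 1) := by decide
      rcases two _ _ hBw with h1 | h1
      · exact Or.inl (hx w ⟨hw, h1⟩)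
      · exact Or.inr (hy w ⟨hw, h1⟩)
    -- For an edge with equal labels on its right, this picks the only end that can carry an
    -- alternation: the two labels coincide at one end at most.
    let a : G.Dart → G.Dart := fun w => if B w = B (P.rot w) then w else P.next w
    refine (Set.ncard_le_ncard (t := {a x, a y}) ?_).trans
      ((Set.ncard_insert_le _ _).trans (by simp))
    rintro d ⟨hd, halt⟩
    have h1 := P.rot_symm_fst d
    cases hc : c d.fst
    · rw [bipolarDir_of_black (by rw [h1, hc]), bipolarDir_of_black hc] at halt
      have h2 := dec _ _ halt
      obtain ⟨w, rfl⟩ := P.next.surjective d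
      have hw : c w.fst = true := by
        rw [P.next_fst] at hc
        have h3 := coloring_symm_fst c w
        change c w.snd = _ at h3
        rw [hc] at h3
        simpa using h3.symm
      have h4 : P.rot.symm (P.next w) = w.symm := by
        rw [P.next_apply, Equiv.symm_apply_apply]
      rw [h4] at h2
      obtain ⟨-, k1, k2⟩ := h.labels hw
      have h5 : a w = P.next w := if_neg fun h6 => (k1 h6).2 h2
      rw [← h5]
      rcases hmono w ((P.faceRight_next w).symm.trans hd) (k2 h2) with rfl | rfl <;> simp
    · rw [bipolarDir_of_white (by rw [h1, hc]), bipolarDir_of_white hc,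
        Equiv.apply_symm_apply] at halt
      have h2 := dec _ _ halt
      have h5 : a d = d := if_pos h2
      rw [← h5]
      rcases hmono d hd ((h.labels hc).2.1 h2).1 with rfl | rfl <;> simp

/-- An outgoing arc is a label change at the tail, whose color depends only on the sense of the
change and the color class of the tail. This turns the vertex rule into out-degree one for each
color. -/
theorem arc_iff (h : P.IsGeneralizedStrongLabeling c s B) (i : Fin 2) (d : G.Dart) :
    P.IsUnidirected B i d ∨ P.IsBidirected c B i d ↔
      B d = (if c d.fst = true then i else 1 - i) ∧
        B (P.rot d) = 1 - (if c d.fst = true then i else 1 - i) := by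
  simp only [IsUnidirected, IsBidirected, AngleLabeling.tailLeft, AngleLabeling.tailRight,
    AngleLabeling.headLeft, AngleLabeling.headRight]
  cases hd : c d.fst
  · have key : ∀ i wl wr bl br : Fin 2, (∃ i : Fin 2,
        (wl = 1 - i ∧ wr = i ∧ bl = i ∧ br = i) ∨ (wl = i ∧ wr = i ∧ bl = 1 - i ∧ br = i) ∨
        (wl = 1 - i ∧ wr = i ∧ bl = i ∧ br = 1 - i)) →
        ((br ≠ bl ∧ wr = i ∧ wl = i ∨ br ≠ bl ∧ wr ≠ wl ∧ br = i) ↔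
          bl = 1 - i ∧ br = 1 - (1 - i)) := by decide
    have := h.edge d.symm (by rw [coloring_symm_fst, hd]; rfl)
    simp only [AngleLabeling.tailLeft, AngleLabeling.tailRight,
      AngleLabeling.headLeft, AngleLabeling.headRight, SimpleGraph.Dart.symm_symm] at this
    simpa using key i _ _ _ _ this
  · have key : ∀ i wl wr bl br : Fin 2, (∃ i : Fin 2,
        (wl = 1 - i ∧ wr = i ∧ bl = i ∧ br = i) ∨ (wl = i ∧ wr = i ∧ bl = 1 - i ∧ br = i) ∨
        (wl = 1 - i ∧ wr = i ∧ bl = i ∧ br = 1 - i)) →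
        ((wl ≠ wr ∧ bl = i ∧ br = i ∨ wl ≠ wr ∧ bl ≠ br ∧ wr = i) ↔ wr = i ∧ wl = 1 - i) := by
      decide
    simpa using key i (B (P.rot d)) (B d) (B d.symm) (B (P.rot d.symm)) (h.edge d hd)

theorem bipolarDir_of_arc_zero (h : P.IsGeneralizedStrongLabeling c s B) {d : G.Dart}
    (hd : P.IsUnidirected B 0 d ∨ P.IsBidirected c B 0 d) : P.bipolarDir c B d = true := by
  obtain ⟨h1, h2⟩ := (h.arc_iff 0 d).1 hd
  cases hc : c d.fst
  · rw [bipolarDir_of_black hc, h1, hc]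
    rfl
  · rw [bipolarDir_of_white hc, h2, hc]
    rfl

theorem bipolarDir_of_arc_one [Finite V] (h : P.IsGeneralizedStrongLabeling c s B) {d : G.Dart}
    (hd : P.IsUnidirected B 1 d ∨ P.IsBidirected c B 1 d) :
    P.bipolarDir c B d.symm = true := by
  obtain ⟨h1, h2⟩ := (h.arc_iff 1 d).1 hd
  rw [h.isBipolar.symm]
  cases hc : c d.fst
  · rw [bipolarDir_of_black hc, h1, hc]
    rfl
  · rw [bipolarDir_of_white hc, h2, hc]
    rfl

theorem acyclic_zero_one [Finite V] (h : P.IsGeneralizedStrongLabeling c s B) :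
    DigraphAcyclic (UnionReverse (P.GeneralizedT c B 0) (P.GeneralizedT c B 1)) := by
  refine fun v hv => h.isBipolar.acyclic v (Relation.TransGen.mono ?_ _ _ hv)
  rintro u w (⟨d, rfl, rfl, hd⟩ | ⟨d, rfl, rfl, hd⟩)
  · exact ⟨d, rfl, rfl, h.bipolarDir_of_arc_zero hd⟩
  · exact ⟨d.symm, rfl, rfl, h.bipolarDir_of_arc_one hd⟩

theorem acyclic_one_zero [Finite V] (h : P.IsGeneralizedStrongLabeling c s B) :
    DigraphAcyclic (UnionReverse (P.GeneralizedT c B 1) (P.GeneralizedT c B 0)) := by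
  refine fun v hv => h.acyclic_zero_one v
    (Relation.transGen_swap.1 (Relation.TransGen.mono ?_ _ _ hv))
  exact fun u w huw => huw.symm

theorem arc_ne_special (h : P.IsGeneralizedStrongLabeling c s B) {i : Fin 2} {d : G.Dart}
    (hd : P.IsUnidirected B i d ∨ P.IsBidirected c B i d) (j : Fin 2) : d.fst ≠ s j := by
  intro hj
  have h1 : B (P.rot d) ≠ B d := hd.elim (fun h => h.1) (fun h => h.1)
  have hB := (h.special.2 j).2
  exact h1 (by rw [hB d hj, hB _ ((P.rot_fst d).trans hj)])

theorem arc_snd_ne (h : P.IsGeneralizedStrongLabeling c s B) {i : Fin 2} {d : G.Dart}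
    (hd : P.IsUnidirected B i d ∨ P.IsBidirected c B i d) : d.snd ≠ s (1 - i) := by
  intro hj
  have hB := (h.special.2 (1 - i)).2
  have h1 : B d.symm = 1 - i := hB _ hj
  have h2 : B (P.rot d.symm) = 1 - i := hB _ ((P.rot_fst d.symm).trans hj)
  have hi : ∀ i : Fin 2, 1 - i ≠ i := by decide
  rcases hd with hd | hd
  · exact hi i (h1.symm.trans hd.2.1)
  · exact hd.2.1 (h1.trans h2.symm)

theorem existsUnique_arc [Finite V] (h : P.IsGeneralizedStrongLabeling c s B) (i : Fin 2) {v : V}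
    (h₀ : v ≠ s 0) (h₁ : v ≠ s 1) : ∃! w, P.GeneralizedT c B i v w := by
  obtain ⟨d, ⟨rfl, hd⟩, huniq⟩ :=
    h.vertex.existsUnique h₀ h₁ (if c v = true then i else 1 - i)
  refine ⟨d.snd, ⟨d, rfl, rfl, (h.arc_iff i d).2 hd⟩, ?_⟩
  rintro w ⟨e, he, rfl, harc⟩
  rw [huniq e ⟨he, by simpa only [he] using (h.arc_iff i e).1 harc⟩]

end IsGeneralizedStrongLabeling

/-! ### Strong labelings of quadrangulations -/

theorem IsQuadrangulation.next_pow_four [Finite V] (hQ : P.IsQuadrangulation) {d e : G.Dart}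
    (hde : P.faceRight e = P.faceRight d) :
    P.next (P.next (P.next (P.next d))) = d ∧
      (e = d ∨ e = P.next d ∨ e = P.next (P.next d) ∨ e = P.next (P.next (P.next d))) := by
  classical
  have := Fintype.ofFinite G.Dart
  have hne : P.next d ≠ d := by
    intro h
    have h1 := P.next_fst d
    rw [h] at h1
    exact d.adj.ne h1
  have hcard : (P.next.cycleOf d).support.card = 4 := by
    rw [← hQ (P.faceRight d), Nat.card_eq_fintype_card, Fintype.card_subtype]
    congr 1
    ext x
    rw [Finset.mem_filter, P.faceRight_eq_iff,
      Equiv.Perm.mem_support_cycleOf_iff' hne]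
    exact ⟨fun h => ⟨Finset.mem_univ _, h.symm⟩, fun h => h.2.symm⟩
  constructor
  · have h1 := (Equiv.Perm.isCycle_cycleOf P.next hne).orderOf
    rw [hcard] at h1
    have h2 := pow_orderOf_eq_one (P.next.cycleOf d)
    rw [h1] at h2
    have h3 := Equiv.Perm.cycleOf_pow_apply_self P.next d 4
    rw [h2] at h3
    exact h3.symm
  · obtain ⟨k, hk, rfl⟩ := ((P.faceRight_eq_iff d e).1 hde.symm).exists_pow_eq_of_mem_support
      (Equiv.Perm.mem_support.2 hne)
    rw [hcard] at hk
    interval_cases k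
    · exact Or.inl rfl
    · exact Or.inr (Or.inl rfl)
    · exact Or.inr (Or.inr (Or.inl rfl))
    · exact Or.inr (Or.inr (Or.inr rfl))

namespace IsStrongLabeling

/-- Along a face labeled 0011, equal and unequal consecutive pairs alternate, as the color classes
do. Across an edge, (G2) makes the labels on one side equal exactly when those on the other side
differ. The equivalence thus spreads to all darts from the outer dart that ends at the black vertex
`s 0`. -/
theorem white_iff [Finite V] (hQ : P.IsQuadrangulation) (h : P.IsStrongLabeling c s B)
    (d : G.Dart) : c d.fst = true ↔ B d = B (P.next d) := by
  have hnext : ∀ e, (c e.fst = true ↔ B e = B (P.next e)) →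
      (c (P.next e).fst = true ↔ B (P.next e) = B (P.next (P.next e))) := by
    intro e he
    obtain ⟨d, hd, b0, b1, b2, b3⟩ := h.face.1 (P.faceRight e)
    obtain ⟨h4, hcase⟩ := hQ.next_pow_four hd.symm
    rw [P.next_fst, show e.snd = e.symm.fst from rfl, coloring_symm_fst]
    have hsw : B e = B (P.next e) ↔ ¬ B (P.next e) = B (P.next (P.next e)) := by
      rcases hcase with rfl | rfl | rfl | rfl <;> simp [h4, b0, b1, b2, b3]
    rw [hsw] at he
    cases hc : c e.fst <;> simp [hc] at he ⊢ <;> exact he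
  have hsymm : ∀ e, (c e.fst = true ↔ B e = B (P.next e)) →
      (c e.symm.fst = true ↔ B e.symm = B (P.next e.symm)) := by
    intro e he
    have key : ∀ tl tr hl hr : Fin 2, Xor (tl = tr) (hl = hr) → (tr = hr ↔ ¬ hl = tl) := by
      unfold Xor
      decide
    have h1 : B e = B (P.next e) ↔ ¬ B e.symm = B (P.rot e) := key _ _ _ _ (h.edge e)
    rw [h1] at he
    rw [coloring_symm_fst, P.next_apply, SimpleGraph.Dart.symm_symm]
    cases hc : c e.fst <;> simp [hc] at he ⊢ <;> exact he
  obtain ⟨d₀, -, hfst, b0, b1, -, -⟩ := h.face.2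
  refine P.dart_induction (p := fun d => c d.fst = true ↔ B d = B (P.next d)) (fun e he => ?_)
    hsymm (d := P.next.symm d₀) ?_ d
  · have := hnext _ (hsymm e he)
    rwa [P.next_apply e.symm, SimpleGraph.Dart.symm_symm] at this
  · have h1 := P.next_fst (P.next.symm d₀)
    have h2 := coloring_symm_fst c (P.next.symm d₀)
    change c (P.next.symm d₀).snd = _ at h2
    rw [← h1, Equiv.apply_symm_apply, hfst, h.special_black] at h2
    rw [Equiv.apply_symm_apply, b0, b1]
    simpa using h2.symm

/-- By `white_iff` the right labels agree from white to black, and (G2) then leaves only the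
unidirected patterns. -/
theorem isGeneralizedStrongLabeling [Finite V] (hQ : P.IsQuadrangulation)
    (h : P.IsStrongLabeling c s B) : P.IsGeneralizedStrongLabeling c s B where
  special := h.special
  vertex := h.vertex
  edge d hd := by
    have key : ∀ tl tr hl hr : Fin 2, Xor (tl = tr) (hl = hr) → tr = hr →
        (tl = 1 - tr ∧ tr = tr ∧ hl = tr ∧ hr = tr) ∨
        (tl = tr ∧ tr = tr ∧ hl = 1 - tr ∧ hr = tr) ∨
        (tl = 1 - tr ∧ tr = tr ∧ hl = tr ∧ hr = 1 - tr) := by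
      unfold Xor
      decide
    exact ⟨B d, key _ _ _ _ (h.edge d) ((h.white_iff hQ d).1 hd)⟩
  face := by
    constructor
    · intro F i
      obtain ⟨d, rfl, b0, b1, b2, b3⟩ := h.face.1 F
      have hF : P.faceRight (P.next (P.next d)) = P.faceRight d := by
        rw [P.faceRight_next, P.faceRight_next]
      have huniq : ∀ e, P.faceRight e = P.faceRight d → B e = B (P.next e) →
          e = d ∧ B e = 0 ∨ e = P.next (P.next d) ∧ B e = 1 := by
        intro e he hB
        obtain ⟨h4, rfl | rfl | rfl | rfl⟩ := hQ.next_pow_four he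
        · exact Or.inl ⟨rfl, b0⟩
        · simp [b1, b2] at hB
        · exact Or.inr ⟨rfl, b2⟩
        · simp [h4, b0, b3] at hB
      fin_cases i
      · refine ⟨d, ⟨rfl, b0, b1⟩, fun e he => ?_⟩
        rcases huniq e he.1 (he.2.1.trans he.2.2.symm) with h1 | h1
        · exact h1.1
        · exact absurd (he.2.1.symm.trans h1.2) (by decide)
      · refine ⟨P.next (P.next d), ⟨hF, b2, b3⟩, fun e he => ?_⟩
        rcases huniq e he.1 (he.2.1.trans he.2.2.symm) with h1 | h1
        · exact absurd (he.2.1.symm.trans h1.2) (by decide)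
        · exact h1.1
    · obtain ⟨d, hd, hfst, b0, b1, -, -⟩ := h.face.2
      refine ⟨P.next.symm d, ?_, Or.inr ?_, ?_, b1, ?_⟩
      · rw [← hd, ← P.faceRight_next (P.next.symm d), Equiv.apply_symm_apply]
      · rw [← P.next_fst, Equiv.apply_symm_apply, hfst]
      · rw [h.white_iff hQ, Equiv.apply_symm_apply, b0, b1]
      · rw [Equiv.apply_symm_apply, b0]

theorem strongT_eq (h : P.IsStrongLabeling c s B) (i : Fin 2) :
    P.StrongT B i = P.GeneralizedT c B i := by
  funext u v
  refine propext ⟨?_, ?_⟩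
  · rintro ⟨d, hu, hv, hd⟩
    exact ⟨d, hu, hv, Or.inl hd⟩
  · rintro ⟨d, hu, hv, hd | hd⟩
    · exact ⟨d, hu, hv, hd⟩
    · rcases h.edge d with h1 | h1
      · exact absurd h1.1 hd.1
      · exact absurd h1.1 hd.2.1

end IsStrongLabeling

end PlaneGraph

/-! ### Trees from acyclicity and out-degree one -/

/-- Following out-arcs must stop, and can stop only at `r`; this gives connectedness. Sending each
vertex other than `r` to its out-arc counts the edges as `|S| - 1`; two vertices sharing an edge
would form a directed 2-cycle. -/
theorem IsDirectedTree.of_existsUnique {V : Type*} [Finite V] {R : V → V → Prop} {S : Set V}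
    {r : V} (hacyc : DigraphAcyclic R) (hmem : ∀ u v, R u v → u ∈ S ∧ v ∈ S) (hr : r ∈ S)
    (hsink : ∀ v, ¬ R r v) (hout : ∀ v ∈ S, v ≠ r → ∃! w, R v w) : IsDirectedTree R S r := by
  have hasymm : ∀ u v, R u v → ¬ R v u := fun u v h1 h2 => hacyc u (.tail (.single h1) h2)
  have hne : ∀ u v, R u v → u ≠ v := by
    rintro u v h rfl
    exact hacyc u (.single h)
  have hpath : ∀ v ∈ S, Relation.ReflTransGen R v r := by
    have hirr : Std.Irrefl (Relation.TransGen (Function.swap R)) :=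
      ⟨fun v hv => hacyc v (Relation.transGen_swap.1 hv)⟩
    have wf := Finite.wellFounded_of_trans_of_irrefl (Relation.TransGen (Function.swap R))
    intro v
    induction v using wf.induction with
    | h v ih =>
      intro hv
      by_cases hvr : v = r
      · exact hvr ▸ .refl
      · obtain ⟨w, hw, -⟩ := hout v hv hvr
        exact .head hw (ih w (.single hw) (hmem _ _ hw).2)
  refine ⟨hmem, hasymm, ?_, hr, hsink, hpath⟩
  rw [SimpleGraph.isTree_iff_connected_and_card]
  constructor
  · have hreach : ∀ v, Relation.ReflTransGen R v r → ∀ hv : v ∈ S,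
        ((SimpleGraph.fromRel R).induce S).Reachable ⟨v, hv⟩ ⟨r, hr⟩ := by
      intro v hv
      induction hv using Relation.ReflTransGen.head_induction_on with
      | refl => exact fun _ => SimpleGraph.Reachable.refl _
      | head h1 _ ih =>
        intro hv
        refine SimpleGraph.Reachable.trans (SimpleGraph.Adj.reachable ?_) (ih (hmem _ _ h1).2)
        exact ⟨hne _ _ h1, Or.inl h1⟩
    have : Nonempty S := ⟨⟨r, hr⟩⟩
    exact ⟨fun u v => (hreach u (hpath u u.2) u.2).trans (hreach v (hpath v v.2) v.2).symm⟩
  · choose f hf huniq using fun v : {v : S // v ≠ ⟨r, hr⟩} =>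
      hout v.1 v.1.2 fun h => v.2 (Subtype.ext h)
    have hS : Nat.card {v : S // v ≠ ⟨r, hr⟩} + 1 = Nat.card S := by
      rw [← Set.ncard_add_ncard_compl ({⟨r, hr⟩} : Set S), Set.ncard_singleton, add_comm]
      rfl
    rw [← hS]
    congr 1
    symm
    refine Nat.card_congr (Equiv.ofBijective (fun v => ⟨s(v.1, ⟨f v, (hmem _ _ (hf v)).2⟩),
      ⟨hne _ _ (hf v), Or.inl (hf v)⟩⟩) ⟨fun u v huv => ?_, ?_⟩)
    · have h1 := congrArg Subtype.val huv
      rw [Sym2.eq_iff] at h1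
      rcases h1 with h1 | ⟨h1, h2⟩
      · exact Subtype.ext h1.1
      · have k1 := hf u
        have k2 := hf v
        rw [congrArg Subtype.val h1] at k1
        rw [← congrArg Subtype.val h2] at k2
        exact absurd k1 fun k1 => hacyc _ (.tail (.single k1) (by simpa [h1, h2] using k2))
    · rintro ⟨e, he⟩
      induction e using Sym2.ind with
      | _ u v =>
        have key : ∀ u v : S, R u v → ∃ x : {v : S // v ≠ ⟨r, hr⟩},
            s(x.1, (⟨f x, (hmem _ _ (hf x)).2⟩ : S)) = s(u, v) := by
          intro u v huv
          have hur : u ≠ ⟨r, hr⟩ := by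
            rintro rfl
            exact hsink _ huv
          refine ⟨⟨u, hur⟩, ?_⟩
          exact congrArg (fun x => s(u, x)) (Subtype.ext (huniq ⟨u, hur⟩ v huv).symm)
        rcases he.2 with h1 | h1
        · obtain ⟨x, hx⟩ := key u v h1
          exact ⟨x, Subtype.ext hx⟩
        · obtain ⟨x, hx⟩ := key v u h1
          exact ⟨x, Subtype.ext (hx.trans Sym2.eq_swap)⟩

theorem PlaneGraph.IsGeneralizedStrongLabeling.isDirectedTree {V : Type*} [Finite V]
    {G : SimpleGraph V} {P : PlaneGraph G} {c : G.Coloring Bool} {s : Fin 2 → V}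
    {B : AngleLabeling G} (h : P.IsGeneralizedStrongLabeling c s B) (i : Fin 2) :
    IsDirectedTree (P.GeneralizedT c B i) {v | v ≠ s (1 - i)} (s i) := by
  have hij : s i ≠ s (1 - i) := by
    fin_cases i
    · exact h.special.1
    · exact h.special.1.symm
  refine IsDirectedTree.of_existsUnique ?_ ?_ hij ?_ ?_
  · intro v hv
    fin_cases i
    · exact h.acyclic_zero_one v (Relation.TransGen.mono (fun _ _ => Or.inl) _ _ hv)
    · exact h.acyclic_one_zero v (Relation.TransGen.mono (fun _ _ => Or.inl) _ _ hv)
  · rintro u v ⟨d, rfl, rfl, hd⟩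
    exact ⟨h.arc_ne_special hd _, h.arc_snd_ne hd⟩
  · rintro v ⟨d, hu, -, hd⟩
    exact h.arc_ne_special hd i hu
  · intro v hv hvi
    fin_cases i
    · exact h.existsUnique_arc _ hvi hv
    · exact h.existsUnique_arc _ hv hvi

theorem mainTheorem12 {V : Type*} [Finite V] (G : SimpleGraph V) (P : PlaneGraph G)
    (c : G.Coloring Bool) (s : Fin 2 → V) (B : AngleLabeling G) :
    (P.IsQuadrangulation → P.IsStrongLabeling c s B →
      ∀ i : Fin 2, IsDirectedTree (P.StrongT B i) {v | v ≠ s (1 - i)} (s i)) ∧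
    (P.IsGeneralizedStrongLabeling c s B →
      DigraphAcyclic (UnionReverse (P.GeneralizedT c B 0) (P.GeneralizedT c B 1)) ∧
      DigraphAcyclic (UnionReverse (P.GeneralizedT c B 1) (P.GeneralizedT c B 0)) ∧
      ∀ i : Fin 2, IsDirectedTree (P.GeneralizedT c B i) {v | v ≠ s (1 - i)} (s i)) := by
  refine ⟨fun hQ h i => ?_, fun h => ⟨h.acyclic_zero_one, h.acyclic_one_zero, h.isDirectedTree⟩⟩
  rw [h.strongT_eq]
  exact (h.isGeneralizedStrongLabeling hQ).isDirectedTree i
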